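/- Let $\mathbb A$ be a finite alphabet and let $w_1$ be a finite word over $\mathbb A$ containing two different letters. Let $q_n\ge 2$ $(n\ge 1)$ be integers, put $h_1=|w_1|$ and $h_{n+1}=q_nh_n$, and suppose that $q_n\sim h_n^{\gamma}$ as $n\to\infty$ (that is, $q_n/h_n^\gamma\to1$) for some real $\gamma\ge 1$. Let $\alpha_n(j)$, $n\ge1$, $1\le j<q_n$, be independent random variables on a probability space, $\alpha_n(j)$ being uniformly distributed on the integers of $[0,h_n)$. For a word $w=uv$ with $|u|=\alpha$ let $\rho_\alpha(w)=vu$ denote its cyclic rotation. Define the random iceberg system (without spacers) by $$w_{n+1}=w_n\,\rho_{\alpha_n(1)}(w_n)\,\rho_{\alpha_n(2)}(w_n)\cdots\rho_{\alpha_n(q_n-1)}(w_n),$$ so that $|w_n|=h_n$, and let $w_\infty$ be the one-sided infinite word that has every $w_n$ as a prefix. Let $p_{w_\infty}(l)$ be the number of different subwords (blocks of consecutive letters) of length $l$ of $w_\infty$. Then, almost surely, for every $\varepsilon>0$ there is an $l_0=l_0(\varepsilon)$, which may depend on the realization of the system, such that $$p_{w_\infty}(l)\ge l^{3-\varepsilon}\qquad\text{for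 all integers } l\ge l_0 .$$ -/

import Mathlib

open Filter MeasureTheory ProbabilityTheory
open scoped Asymptotics

/-- The deterministic data of an iceberg system without spacers over the alphabet `A`: an initial
word containing two different letters, and the numbers `q n ≥ 2` of blocks used at each step.
Steps are numbered from `0`. -/
structure IcebergScheme (A : Type*) where
  /-- the initial word -/
  base : List A
  /-- the initial word contains a pair of different letters -/
  base_nontrivial : ∃ a ∈ base, ∃ b ∈ base, a ≠ b
  /-- the number of rotated copies concatenated at step `n` -/
  q : ℕ → ℕ
  two_le_q : ∀ n, 2 ≤ q n

namespace IcebergScheme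

variable {A : Type*} (S : IcebergScheme A)

/-- The length `h n` of the `n`-th word, see `length_word`. -/
def height : ℕ → ℕ
  | 0 => S.base.length
  | n + 1 => S.q n * height n

/-- The `n`-th word for the rotation parameters `r n j`:
`w (n+1) = w n ++ ρ_{r n 1} (w n) ++ ⋯ ++ ρ_{r n (q n - 1)} (w n)`, where
`ρ_α (w₁ w₂) = w₂ w₁` for `|w₁| = α` is the cyclic rotation `List.rotate`.
The `0`-th block is not rotated, so the values `r n 0` are not used. -/
def word (r : ℕ → ℕ → ℕ) : ℕ → List A
  | 0 => S.base
  | n + 1 => word r n ++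
      (List.range (S.q n - 1)).flatMap fun j => (word r n).rotate (r n (j + 1))

theorem length_word (r : ℕ → ℕ → ℕ) (n : ℕ) : (S.word r n).length = S.height n := by
  induction n with
  | zero => rfl
  | succ n ih =>
    have h2 := S.two_le_q n
    obtain ⟨k, hk⟩ : ∃ k, S.q n = k + 1 := ⟨S.q n - 1, by omega⟩
    simp [word, height, List.length_flatMap, ih, hk]
    ring

theorem lt_height (n : ℕ) : n < S.height n := by
  induction n with
  | zero =>
    obtain ⟨a, ha, -⟩ := S.base_nontrivial
    exact List.length_pos_of_mem ha
  | succ n ih =>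
    have h2 := S.two_le_q n
    have : 2 * S.height n ≤ S.q n * S.height n := Nat.mul_le_mul_right _ h2
    simp only [height]
    omega

/-- The infinite word which has every `S.word r n` as a prefix, see `limitWord_eq`. -/
def limitWord (r : ℕ → ℕ → ℕ) (i : ℕ) : A :=
  (S.word r i)[i]'(by rw [length_word]; exact S.lt_height i)

theorem word_prefix (r : ℕ → ℕ → ℕ) {m n : ℕ} (h : m ≤ n) : S.word r m <+: S.word r n := by
  induction n, h using Nat.le_induction with
  | base => exact List.prefix_rfl
  | succ n _ ih => exact ih.trans (List.prefix_append _ _)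

theorem limitWord_eq (r : ℕ → ℕ → ℕ) (n i : ℕ) (hi : i < (S.word r n).length) :
    S.limitWord r i = (S.word r n)[i] := by
  rcases le_total i n with h | h
  · exact (S.word_prefix r h).getElem _
  · exact ((S.word_prefix r h).getElem _).symm

end IcebergScheme

/-- The language of an infinite word: the set of all its finite subwords
(blocks of consecutive letters). -/
def wordLanguage {A : Type*} (x : ℕ → A) : Set (List A) :=
  {u | ∃ i, ∀ k (hk : k < u.length), u[k] = x (i + k)}

/-- Symbolic complexity: the number of different subwords of length `l`. -/
noncomputable def wordComplexity {A : Type*} (x : ℕ → A) (l : ℕ) : ℕ :=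
  {u ∈ wordLanguage x | u.length = l}.ncard

/-! Almost surely every nonempty word over the letters of the initial word occurs in the limit word,
so with two letters available the complexity is at least `2 ^ l`, which beats every `l ^ (3 - ε)`.

Call `u` abundant at level `n` if it occurs more than `2 * (|u| - 1)` times in the `n`-th word.
Rotating a block destroys at most `|u| - 1` occurrences, so abundance makes the frequency of `u`
stay bounded below at all later levels (`Abundant.height_le`). If `x` and `y` are abundant with
frequencies at least `1 / d`, then given the `n`-th word a pair of consecutive rotated blocks shows
`x` at the end of the first and `y` at the start of the second with probability at least `d⁻²`.
Hence `K` such pairs in a row succeed together with a probability bounded below independently of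
`n`. The number of disjoint groups of `K` pairs grows with `q n → ∞`, so almost surely some group
succeeds, and for suitable `K` this makes `x ++ y` abundant (`ae_exists_abundant_append`). Single
letters are abundant at level `0`; induction on the length does the rest. -/

/-! ### Counting occurrences under concatenation and rotation -/

section Occurrences

variable {A : Type*}

open Classical in
/-- The positions at which the word `u` occurs in the word `w`. -/
noncomputable def occurrences (u w : List A) : Finset ℕ :=
  {i ∈ Finset.range w.length | u <+: w.drop i}

theorem mem_occurrences {u w : List A} {i : ℕ} :
    i ∈ occurrences u w ↔ i < w.length ∧ u <+: w.drop i := by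
  simp [occurrences]

theorem add_length_le_of_mem_occurrences {u w : List A} {i : ℕ} (h : i ∈ occurrences u w) :
    i + u.length ≤ w.length := by
  obtain ⟨hi, hu⟩ := mem_occurrences.1 h
  have := hu.length_le
  rw [List.length_drop] at this
  omega

theorem card_occurrences_append_ge (u x y : List A) :
    (occurrences u x).card + (occurrences u y).card ≤ (occurrences u (x ++ y)).card := by
  classical
  rw [← Finset.card_map (addLeftEmbedding x.length) (s := occurrences u y),
    ← Finset.card_union_of_disjoint]
  · refine Finset.card_le_card fun i hi => ?_
    rw [Finset.mem_union, Finset.mem_map] at hi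
    rcases hi with hi | ⟨k, hk, rfl⟩
    · obtain ⟨h1, h2⟩ := mem_occurrences.1 hi
      refine mem_occurrences.2 ⟨by simp; omega, ?_⟩
      rw [List.drop_append_of_le_length h1.le]
      exact h2.trans (List.prefix_append _ _)
    · obtain ⟨h1, h2⟩ := mem_occurrences.1 hk
      refine mem_occurrences.2 ⟨by simpa using h1, ?_⟩
      simpa [addLeftEmbedding] using h2
  · rw [Finset.disjoint_left]
    intro i hi hi'
    obtain ⟨k, -, rfl⟩ := Finset.mem_map.1 hi'
    have := (mem_occurrences.1 hi).1
    simp at this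

/-- The last term counts occurrences straddling the junction: these start among the last `u.length -
1` positions of `x`. -/
theorem card_occurrences_append_le (u x y : List A) :
    (occurrences u (x ++ y)).card ≤
      (occurrences u x).card + (occurrences u y).card + (u.length - 1) := by
  classical
  have hsub : occurrences u (x ++ y) ⊆
      (occurrences u x ∪ (occurrences u y).map (addLeftEmbedding x.length)) ∪
        Finset.Ico (x.length + 1 - u.length) x.length := by
    intro i hi
    obtain ⟨h1, h2⟩ := mem_occurrences.1 hi
    simp only [Finset.mem_union, Finset.mem_map, Finset.mem_Ico]
    by_cases hx : x.length ≤ i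
    · refine .inl (.inr ⟨i - x.length, mem_occurrences.2 ⟨?_, ?_⟩, ?_⟩)
      · rw [List.length_append] at h1
        omega
      · rwa [List.drop_append, List.drop_eq_nil_of_le hx, List.nil_append] at h2
      · simp only [addLeftEmbedding_apply]
        omega
    · by_cases hu : i + u.length ≤ x.length
      · refine .inl (.inl (mem_occurrences.2 ⟨by omega, ?_⟩))
        rw [List.drop_append_of_le_length (by omega)] at h2
        refine List.prefix_of_prefix_length_le h2 (List.prefix_append _ _) ?_
        rw [List.length_drop]
        omega
      · exact .inr (by omega)
  refine (Finset.card_le_card hsub).trans ((Finset.card_union_le _ _).trans ?_)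
  have h1 := Finset.card_union_le (occurrences u x)
    ((occurrences u y).map (addLeftEmbedding x.length))
  rw [Finset.card_map] at h1
  rw [Nat.card_Ico]
  omega

/-- A rotation cuts the word once and swaps the two pieces, so only occurrences across the cut can
be lost. -/
theorem card_occurrences_le_rotate (u w : List A) (a : ℕ) :
    (occurrences u w).card - (u.length - 1) ≤ (occurrences u (w.rotate a)).card := by
  have h1 := card_occurrences_append_le u (w.take (a % w.length)) (w.drop (a % w.length))
  have h2 := card_occurrences_append_ge u (w.drop (a % w.length)) (w.take (a % w.length))
  rw [List.take_append_drop] at h1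
  rw [List.rotate_eq_drop_append_take_mod]
  omega

theorem card_occurrences_mono_prefix {u x y : List A} (h : x <+: y) :
    (occurrences u x).card ≤ (occurrences u y).card := by
  obtain ⟨z, rfl⟩ := h
  have := card_occurrences_append_ge u x z
  omega

theorem one_le_card_occurrences {u x y : List A} (hu : u ≠ []) :
    1 ≤ (occurrences u (x ++ (u ++ y))).card := by
  refine Finset.card_pos.2 ⟨x.length, mem_occurrences.2 ⟨?_, ?_⟩⟩
  · have := List.length_pos_of_ne_nil hu
    simp
    omega
  · simp

theorem length_mul_le_card_occurrences_flatMap {ι : Type*} (u : List A) (c : ℕ) (f : ι → List A)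
    (hf : ∀ j, c ≤ (occurrences u (f j)).card) (l : List ι) :
    l.length * c ≤ (occurrences u (l.flatMap f)).card := by
  induction l with
  | nil => simp
  | cons j l ih =>
    have := card_occurrences_append_ge u (f j) (l.flatMap f)
    have := hf j
    rw [List.flatMap_cons, List.length_cons, add_mul]
    omega

theorem le_card_occurrences_flatMap_range (u : List A) (f : ℕ → List A) (j K N : ℕ)
    (hN : j + 2 * K ≤ N)
    (hf : ∀ s < K, 1 ≤ (occurrences u (f (j + 2 * s) ++ f (j + 2 * s + 1))).card) :
    K ≤ (occurrences u ((List.range N).flatMap f)).card := by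
  have key : ∀ s ≤ K, s ≤ (occurrences u ((List.range (j + 2 * s)).flatMap f)).card := by
    intro s
    induction s with
    | zero => simp
    | succ s ih =>
      intro hs
      have h1 := ih (by omega)
      have h2 := hf s (by omega)
      have h3 := card_occurrences_append_ge u ((List.range (j + 2 * s)).flatMap f)
        (f (j + 2 * s) ++ f (j + 2 * s + 1))
      rw [show j + 2 * (s + 1) = j + 2 * s + 1 + 1 by ring, List.range_succ, List.range_succ]
      simp only [List.flatMap_append, List.flatMap_singleton, List.append_assoc]
      omega
  refine (key K le_rfl).trans (card_occurrences_mono_prefix ?_)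
  obtain ⟨d, rfl⟩ := Nat.exists_eq_add_of_le hN
  rw [show List.range (j + 2 * K + d) = _ from List.range_add, List.flatMap_append]
  exact List.prefix_append _ _

/-- The rotations of `w` which end with `x`. -/
noncomputable def rotationsToEnd (x w : List A) : Finset ℕ :=
  (occurrences x w).image fun i => (i + x.length) % w.length

theorem rotationsToEnd_subset (x w : List A) : rotationsToEnd x w ⊆ Finset.range w.length := by
  intro a ha
  obtain ⟨i, hi, rfl⟩ := Finset.mem_image.1 ha
  exact Finset.mem_range.2 (Nat.mod_lt _ (by have := (mem_occurrences.1 hi).1; omega))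

theorem card_rotationsToEnd (x w : List A) :
    (rotationsToEnd x w).card = (occurrences x w).card := by
  refine Finset.card_image_of_injOn fun i hi k hk h => ?_
  have hi := (mem_occurrences.1 hi).1
  have hk := (mem_occurrences.1 hk).1
  have := Nat.ModEq.add_right_cancel' (n := w.length) x.length h
  exact Nat.ModEq.eq_of_lt_of_lt this hi hk

theorem exists_rotate_eq_append {x w : List A} {a : ℕ} (ha : a ∈ rotationsToEnd x w) :
    ∃ z, w.rotate a = z ++ x := by
  obtain ⟨i, hi, rfl⟩ := Finset.mem_image.1 ha
  obtain ⟨-, t, ht⟩ := mem_occurrences.1 hi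
  have hw : w = (w.take i ++ x) ++ t := by
    rw [List.append_assoc, ht, List.take_append_drop]
  have hl := add_length_le_of_mem_occurrences hi
  have hlen : (w.take i ++ x).length = i + x.length := by
    simp
    omega
  refine ⟨t ++ w.take i, ?_⟩
  rw [List.rotate_mod, ← hlen]
  conv_lhs => enter [1]; rw [hw]
  rw [List.rotate_append_length_eq, List.append_assoc]

theorem exists_rotate_eq_append_of_mem_occurrences {y w : List A} {a : ℕ}
    (ha : a ∈ occurrences y w) : ∃ z, w.rotate a = y ++ z := by
  obtain ⟨h1, t, ht⟩ := mem_occurrences.1 ha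
  refine ⟨t ++ w.take a, ?_⟩
  rw [List.rotate_eq_drop_append_take h1.le, ← ht, List.append_assoc]

end Occurrences

/-! ### Abundant words and the joining of two words -/

namespace IcebergScheme

variable {A : Type*} (S : IcebergScheme A)

theorem q_mul_le_card_occurrences_succ (r : ℕ → ℕ → ℕ) (u : List A) (n : ℕ) :
    S.q n * ((occurrences u (S.word r n)).card - (u.length - 1)) ≤
      (occurrences u (S.word r (n + 1))).card := by
  have h1 := length_mul_le_card_occurrences_flatMap u
    ((occurrences u (S.word r n)).card - (u.length - 1))
    (fun j => (S.word r n).rotate (r n (j + 1)))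
    (fun j => card_occurrences_le_rotate _ _ _) (List.range (S.q n - 1))
  have h2 := card_occurrences_append_ge u (S.word r n)
    ((List.range (S.q n - 1)).flatMap fun j => (S.word r n).rotate (r n (j + 1)))
  obtain ⟨k, hk⟩ : ∃ k, S.q n = k + 1 := ⟨S.q n - 1, by have := S.two_le_q n; omega⟩
  rw [word]
  rw [hk] at h1 h2 ⊢
  rw [List.length_range, Nat.add_sub_cancel] at h1
  rw [Nat.add_sub_cancel] at h2 ⊢
  rw [add_mul, one_mul]
  omega

/-- A word `u` is abundant in the word `n` if it has so many occurrences there, that it keeps a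
positive frequency in all the following words. -/
def Abundant (r : ℕ → ℕ → ℕ) (u : List A) (n : ℕ) : Prop :=
  2 * (u.length - 1) < (occurrences u (S.word r n)).card

variable {S}

/-- With `L = |u| - 1` and `M` the number of occurrences, one step gives at least `q * (M - L)`, and
`q ≥ 2` yields `q * (M - L) - 2 * L ≥ q * (M - 2 * L)`. So the excess over `2 * L` grows at least as
fast as the height. -/
theorem Abundant.height_le {r : ℕ → ℕ → ℕ} {u : List A} {m : ℕ} (h : S.Abundant r u m) {n : ℕ}
    (hmn : m ≤ n) : S.height n ≤ (occurrences u (S.word r n)).card * S.height m := by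
  -- The induction needs the excess over `2 * L`, not just the count.
  suffices S.height n + 2 * (u.length - 1) * S.height m ≤
      (occurrences u (S.word r n)).card * S.height m by omega
  induction n, hmn using Nat.le_induction with
  | base =>
    have h' : 2 * (u.length - 1) + 1 ≤ (occurrences u (S.word r m)).card := h
    calc S.height m + 2 * (u.length - 1) * S.height m
        = (2 * (u.length - 1) + 1) * S.height m := by ring
      _ ≤ _ := Nat.mul_le_mul_right _ h'
  | succ n _ ih =>
    refine le_trans ?_ (Nat.mul_le_mul_right _ (S.q_mul_le_card_occurrences_succ r u n))
    set M := (occurrences u (S.word r n)).card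
    set L := u.length - 1
    have h2 := S.two_le_q n
    have h3 : S.height n + L * S.height m ≤ (M - L) * S.height m := by
      rw [Nat.sub_mul M L]
      have : 2 * L * S.height m = L * S.height m + L * S.height m := by ring
      omega
    calc S.height (n + 1) + 2 * L * S.height m
        = S.q n * S.height n + 2 * (L * S.height m) := by rw [height]; ring
      _ ≤ S.q n * S.height n + S.q n * (L * S.height m) := by gcongr
      _ = S.q n * (S.height n + L * S.height m) := by ring
      _ ≤ S.q n * ((M - L) * S.height m) := by gcongr
      _ = _ := by ring

theorem abundant_singleton (r : ℕ → ℕ → ℕ) {a : A} (ha : a ∈ S.base) : S.Abundant r [a] 0 := by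
  obtain ⟨x, y, hxy⟩ := List.append_of_mem ha
  have := one_le_card_occurrences (u := [a]) (x := x) (y := y) (by simp)
  simp only [Abundant, word]
  rw [hxy]
  simpa using this

theorem Abundant.mem_wordLanguage {r : ℕ → ℕ → ℕ} {u : List A} {n : ℕ} (h : S.Abundant r u n) :
    u ∈ wordLanguage (S.limitWord r) := by
  obtain ⟨i, hi⟩ := Finset.card_pos.1 (lt_of_le_of_lt (Nat.zero_le _) h)
  have hl := add_length_le_of_mem_occurrences hi
  refine ⟨i, fun k hk => ?_⟩
  rw [S.limitWord_eq r n (i + k) (by omega), (mem_occurrences.1 hi).2.getElem hk]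
  simp

theorem word_congr {r r' : ℕ → ℕ → ℕ} {n : ℕ}
    (h : ∀ m < n, ∀ j, 1 ≤ j → j < S.q m → r m j = r' m j) : S.word r n = S.word r' n := by
  induction n with
  | zero => rfl
  | succ n ih =>
    rw [word, word, ih fun m hm => h m (by omega)]
    congr 1
    refine List.flatMap_congr fun j hj => ?_
    have := List.mem_range.1 hj
    rw [h n (by omega) (j + 1) (by omega) (by omega)]

theorem limitWord_congr {r r' : ℕ → ℕ → ℕ}
    (h : ∀ m j, 1 ≤ j → j < S.q m → r m j = r' m j) : S.limitWord r = S.limitWord r' := by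
  funext i
  simp only [limitWord, word_congr (S := S) (n := i) fun m _ => h m]

variable (S)

/-- The rotations of the block `j` of the next word which are to produce `x ++ y` in pairs of
consecutive blocks of `w`. -/
noncomputable def joiningRotations (x y w : List A) (j : ℕ) : Finset ℕ :=
  if Even j then rotationsToEnd x w else occurrences y w

theorem joiningRotations_subset (x y w : List A) (j : ℕ) :
    joiningRotations x y w j ⊆ Finset.range w.length := by
  unfold joiningRotations
  split_ifs
  · exact rotationsToEnd_subset x w
  · exact fun i hi => Finset.mem_range.2 (mem_occurrences.1 hi).1

theorem min_card_le_card_joiningRotations (x y w : List A) (j : ℕ) :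
    min (occurrences x w).card (occurrences y w).card ≤ (joiningRotations x y w j).card := by
  unfold joiningRotations
  split_ifs
  · rw [card_rotationsToEnd]
    exact min_le_left _ _
  · exact min_le_right _ _

/-- The shift by one in the block index skips the unrotated block `0`; `hi` keeps the whole group
below `q n`. -/
theorem le_card_occurrences_append (r : ℕ → ℕ → ℕ) {x : List A} (hx : x ≠ []) (y : List A)
    (n K i : ℕ) (hi : 2 * K * (i + 1) < S.q n)
    (h : ∀ t < 2 * K, r n (2 * K * i + t + 1) ∈ joiningRotations x y (S.word r n) t) :
    K ≤ (occurrences (x ++ y) (S.word r (n + 1))).card := by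
  have key := le_card_occurrences_flatMap_range (x ++ y)
    (fun j => (S.word r n).rotate (r n (j + 1))) (2 * K * i) K (S.q n - 1)
    (by rw [mul_add, mul_one] at hi; omega) (by
      intro s hs
      have h1 := h (2 * s) (by omega)
      have h2 := h (2 * s + 1) (by omega)
      simp only [joiningRotations, even_two, Even.mul_right, if_true] at h1
      rw [joiningRotations, if_neg (by simp)] at h2
      obtain ⟨z, hz⟩ := exists_rotate_eq_append h1
      obtain ⟨z', hz'⟩ := exists_rotate_eq_append_of_mem_occurrences h2
      simp only [add_assoc] at hz hz' ⊢
      rw [hz, hz']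
      have := one_le_card_occurrences (u := x ++ y) (x := z) (y := z') (by simp [hx])
      simpa only [List.append_assoc] using this)
  have := card_occurrences_append_ge (x ++ y) (S.word r n)
    ((List.range (S.q n - 1)).flatMap fun j => (S.word r n).rotate (r n (j + 1)))
  rw [word]
  omega

end IcebergScheme

/-! ### Independence for events depending on finitely many integer variables -/

section FiniteDependence

variable {Ω : Type*} {ι : Type*}

/-- Any set `B` will do later: `S → ℕ` is countable, so measurability is automatic. -/
theorem DependsOn.exists_preimage_eq {φ : (ι → ℕ) → Prop} {S : Finset ι} (hφ : DependsOn φ S)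
    (X : ι → Ω → ℕ) :
    ∃ B : Set (S → ℕ), {ω | φ fun i => X i ω} = (fun ω (i : S) => X i ω) ⁻¹' B := by
  classical
  refine ⟨{x | φ fun i => if h : i ∈ S then x ⟨i, h⟩ else 0}, ?_⟩
  ext ω
  simp only [Set.mem_ofPred_eq, Set.mem_preimage]
  refine iff_of_eq (hφ fun i hi => ?_)
  rw [dif_pos (Finset.mem_coe.1 hi)]

variable [MeasurableSpace Ω] {μ : Measure Ω} {X : ι → Ω → ℕ}

theorem measurableSet_setOf_of_dependsOn (hX : ∀ i, Measurable (X i)) {φ : (ι → ℕ) → Prop}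
    {S : Finset ι} (hφ : DependsOn φ S) : MeasurableSet {ω | φ fun i => X i ω} := by
  obtain ⟨B, hB⟩ := hφ.exists_preimage_eq X
  rw [hB]
  exact (measurable_pi_lambda _ fun i : S => hX i) B.to_countable.measurableSet

theorem measure_and_of_dependsOn (hX : ∀ i, Measurable (X i)) (hind : iIndepFun X μ)
    {φ ψ : (ι → ℕ) → Prop} {S T : Finset ι} (hφ : DependsOn φ S) (hψ : DependsOn ψ T)
    (hST : Disjoint S T) :
    μ {ω | (φ fun i => X i ω) ∧ ψ fun i => X i ω} =
      μ {ω | φ fun i => X i ω} * μ {ω | ψ fun i => X i ω} := by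
  obtain ⟨B, hB⟩ := hφ.exists_preimage_eq X
  obtain ⟨C, hC⟩ := hψ.exists_preimage_eq X
  rw [Set.ofPred_and, hB, hC]
  exact (hind.indepFun_finset S T hST hX).measure_inter_preimage_eq_mul B C
    B.to_countable.measurableSet C.to_countable.measurableSet

theorem measure_and_forall_not_le (hX : ∀ i, Measurable (X i)) (hind : iIndepFun X μ)
    {φ : (ι → ℕ) → Prop} {S : Finset ι} (hφ : DependsOn φ S)
    {ψ : ℕ → (ι → ℕ) → Prop} {P : ℕ → Finset ι} (hψ : ∀ i, DependsOn (ψ i) (P i))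
    (hSP : ∀ i, Disjoint S (P i)) (hP : Pairwise fun i j => Disjoint (P i) (P j))
    {δ : ENNReal} {N : ℕ} (hδ : ∀ i < N, δ ≤ μ {ω | ψ i fun p => X p ω}) :
    μ {ω | (φ fun p => X p ω) ∧ ∀ i < N, ¬ ψ i fun p => X p ω} ≤
      μ {ω | φ fun p => X p ω} * (1 - δ) ^ N := by
  classical
  have := hind.isProbabilityMeasure
  induction N with
  | zero => simp
  | succ N ih =>
    have h1 : DependsOn (fun x => φ x ∧ ∀ i < N, ¬ ψ i x)
        ((S ∪ (Finset.range N).biUnion P : Finset ι) : Set ι) := by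
      intro x y hxy
      have e1 : φ x = φ y := hφ fun i hi => hxy i (by
        simp only [Finset.coe_union, Set.mem_union]
        exact .inl hi)
      have e2 : ∀ i < N, ψ i x = ψ i y := fun i hi => hψ i fun j hj => hxy j (by
        simp only [Finset.coe_union, Set.mem_union, Finset.mem_coe, Finset.mem_biUnion,
          Finset.mem_range]
        exact .inr ⟨i, hi, hj⟩)
      simp only [e1]
      refine propext (and_congr_right fun _ => forall₂_congr fun i hi => ?_)
      rw [e2 i hi]
    have h2 : DependsOn (fun x => ¬ ψ N x) (P N : Set ι) := fun x y hxy => by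
      simp only [hψ N hxy]
    have h3 : Disjoint (S ∪ (Finset.range N).biUnion P) (P N) := by
      rw [Finset.disjoint_union_left, Finset.disjoint_biUnion_left]
      exact ⟨hSP N, fun i hi => hP (Finset.mem_range.1 hi).ne⟩
    have h4 : μ {ω | ¬ ψ N fun p => X p ω} ≤ 1 - δ := by
      have := prob_compl_eq_one_sub (μ := μ) (measurableSet_setOf_of_dependsOn hX (hψ N))
      rw [Set.compl_ofPred] at this
      rw [this]
      exact tsub_le_tsub_left (hδ N (by omega)) 1
    calc μ {ω | (φ fun p => X p ω) ∧ ∀ i < N + 1, ¬ ψ i fun p => X p ω}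
        = μ {ω | ((φ fun p => X p ω) ∧ ∀ i < N, ¬ ψ i fun p => X p ω) ∧
            ¬ ψ N fun p => X p ω} := by
          congr 1
          ext ω
          simp only [Set.mem_ofPred_eq, Nat.forall_lt_succ_right, and_assoc]
      _ = _ := measure_and_of_dependsOn hX hind h1 h2 h3
      _ ≤ (μ {ω | φ fun p => X p ω} * (1 - δ) ^ N) * (1 - δ) :=
          mul_le_mul' (ih fun i hi => hδ i (by omega)) h4
      _ = _ := by rw [pow_succ, mul_assoc]

theorem pow_card_le_measure_forall_mem (hind : iIndepFun X μ)
    (P : Finset ι) (B : ι → Finset ℕ) {c : ENNReal}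
    (hc : ∀ p ∈ P, c ≤ μ (X p ⁻¹' (B p : Set ℕ))) :
    c ^ P.card ≤ μ {ω | ∀ p ∈ P, X p ω ∈ B p} := by
  have h := hind.measure_inter_preimage_eq_mul P (sets := fun p => (B p : Set ℕ))
    fun p _ => (B p).measurableSet
  have e : {ω | ∀ p ∈ P, X p ω ∈ B p} = ⋂ p ∈ P, X p ⁻¹' (B p : Set ℕ) := by
    ext ω
    simp
  rw [e, h]
  exact Finset.pow_card_le_prod _ _ _ hc

/-- The bound `h ≤ B.card * d` expresses density at least `1 / d` without division. -/
theorem inv_le_measure_preimage_of_hasLaw {Y : Ω → ℕ} {h d : ℕ}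
    (hY : HasLaw Y (uniformOn (Set.Iio h)) μ) {B : Finset ℕ} (hB : B ⊆ Finset.range h)
    (hd : d ≠ 0) (hh : h ≠ 0) (hBd : h ≤ B.card * d) :
    (d : ENNReal)⁻¹ ≤ μ (Y ⁻¹' (B : Set ℕ)) := by
  rw [← Measure.map_apply_of_aemeasurable hY.aemeasurable B.measurableSet, hY.map_eq,
    ← Finset.coe_Iio, uniformOn_apply_finset]
  have : Finset.Iio h ∩ B = B := Finset.inter_eq_right.2 fun i hi => by
    simpa using hB hi
  rw [this, Nat.card_Iio, ENNReal.le_div_iff_mul_le (.inl (by simpa using hh)) (.inl (by simp)),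
    mul_comm, ← div_eq_mul_inv,
    ENNReal.div_le_iff_le_mul (.inl (by simpa using hd)) (.inl (by simp))]
  exact_mod_cast hBd

end FiniteDependence

/-! ### Rotation indices, disjoint groups and what events depend on -/

namespace IcebergScheme

variable {A : Type*} (S : IcebergScheme A)

/-- The pairs `(n, j)` for which the block `j` of the word `n + 1` is rotated. -/
abbrev RotationIndex : Type := {p : ℕ × ℕ // 1 ≤ p.2 ∧ p.2 < S.q p.1}

open Classical in
/-- The rotation parameters given by a family over `S.RotationIndex`, extended by `0`. -/
noncomputable def extend (x : S.RotationIndex → ℕ) (n j : ℕ) : ℕ :=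
  if h : 1 ≤ j ∧ j < S.q n then x ⟨(n, j), h⟩ else 0

theorem extend_of_lt (x : S.RotationIndex → ℕ) {n j : ℕ} (h1 : 1 ≤ j) (h2 : j < S.q n) :
    S.extend x n j = x ⟨(n, j), h1, h2⟩ := dif_pos ⟨h1, h2⟩

/-- The indices of the rotations which determine the word `n`. -/
def indicesBelow (n : ℕ) : Finset S.RotationIndex :=
  ((Finset.range n).biUnion fun m => (Finset.range (S.q m)).image (Prod.mk m)).subtype _

/-- The indices of the `i`-th group of `k` consecutive rotated blocks of the word `n + 1`. -/
def blockGroup (n k i : ℕ) : Finset S.RotationIndex :=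
  ((Finset.Ico (k * i + 1) (k * i + 1 + k)).image (Prod.mk n)).subtype _

theorem mem_indicesBelow {n : ℕ} {p : S.RotationIndex} :
    p ∈ S.indicesBelow n ↔ p.1.1 < n := by
  obtain ⟨⟨m, j⟩, h⟩ := p
  simpa [indicesBelow] using fun _ => h.2

theorem mem_blockGroup {n k i : ℕ} {p : S.RotationIndex} :
    p ∈ S.blockGroup n k i ↔ p.1.1 = n ∧ k * i + 1 ≤ p.1.2 ∧ p.1.2 < k * i + 1 + k := by
  obtain ⟨⟨m, j⟩, h⟩ := p
  simp only [blockGroup, Finset.mem_subtype, Finset.mem_image, Finset.mem_Ico, Prod.mk.injEq]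
  constructor
  · rintro ⟨j', hj, rfl, rfl⟩
    exact ⟨rfl, hj⟩
  · rintro ⟨rfl, hj⟩
    exact ⟨j, hj, rfl, rfl⟩

theorem card_blockGroup_le (n k i : ℕ) : (S.blockGroup n k i).card ≤ k := by
  rw [blockGroup, Finset.card_subtype]
  refine (Finset.card_filter_le _ _).trans (Finset.card_image_le.trans ?_)
  simp

theorem pairwise_disjoint_blockGroup (n k : ℕ) :
    Pairwise fun i j => Disjoint (S.blockGroup n k i) (S.blockGroup n k j) := by
  have key : ∀ i j, i < j → Disjoint (S.blockGroup n k i) (S.blockGroup n k j) := by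
    intro i j hij
    rw [Finset.disjoint_left]
    intro p hp hp'
    have h1 := (S.mem_blockGroup.1 hp).2.2
    have h2 := (S.mem_blockGroup.1 hp').2.1
    have h3 : k * (i + 1) ≤ k * j := Nat.mul_le_mul_left _ hij
    rw [mul_add] at h3
    omega
  intro i j hij
  rcases lt_or_gt_of_ne hij with h | h
  · exact key i j h
  · exact (key j i h).symm

theorem disjoint_indicesBelow_blockGroup (n k i : ℕ) :
    Disjoint (S.indicesBelow n) (S.blockGroup n k i) := by
  rw [Finset.disjoint_left]
  intro p hp hp'
  have h1 := S.mem_indicesBelow.1 hp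
  have h2 := (S.mem_blockGroup.1 hp').1
  omega

theorem dependsOn_word (n : ℕ) (φ : List A → Prop) :
    DependsOn (fun x => φ (S.word (S.extend x) n)) (S.indicesBelow n : Set S.RotationIndex) := by
  intro x y hxy
  refine congrArg φ (word_congr fun m hm j h1 h2 => ?_)
  rw [S.extend_of_lt _ h1 h2, S.extend_of_lt _ h1 h2]
  exact hxy _ (S.mem_indicesBelow.2 hm)

/-- The rotations of the `i`-th group of `2 * K` blocks are such that the blocks, if they are
rotations of `w`, form `K` pairs which produce `x ++ y`. -/
def GroupJoins (x y w : List A) (n K i : ℕ) (r : S.RotationIndex → ℕ) : Prop :=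
  ∀ p ∈ S.blockGroup n (2 * K) i, r p ∈ joiningRotations x y w (p.1.2 - (2 * K * i + 1))

theorem dependsOn_groupJoins (x y w : List A) (n K i : ℕ) :
    DependsOn (S.GroupJoins x y w n K i) (S.blockGroup n (2 * K) i : Set S.RotationIndex) := by
  intro r r' h
  refine propext (forall₂_congr fun p hp => ?_)
  rw [h p hp]

variable {S}

theorem GroupJoins.le_card_occurrences {r : S.RotationIndex → ℕ} {x y : List A} {n K i : ℕ}
    (hx : x ≠ []) (hi : 2 * K * (i + 1) < S.q n)
    (h : S.GroupJoins x y (S.word (S.extend r) n) n K i r) :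
    K ≤ (occurrences (x ++ y) (S.word (S.extend r) (n + 1))).card := by
  refine S.le_card_occurrences_append _ hx y n K i hi fun t ht => ?_
  have hq : 2 * K * i + t + 1 < S.q n := by
    rw [mul_add] at hi
    omega
  rw [S.extend_of_lt _ (by omega) hq]
  have := h ⟨(n, 2 * K * i + t + 1), by omega, hq⟩ (S.mem_blockGroup.2 ⟨rfl, by simp, by
    simp only
    omega⟩)
  convert this using 2
  simp only
  omega

/-! ### Almost sure appearance of all words -/

section Probability

variable {Ω : Type*} [MeasurableSpace Ω] {μ : Measure Ω} {X : S.RotationIndex → Ω → ℕ}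

theorem le_measure_groupJoins (hind : iIndepFun X μ)
    (hunif : ∀ p, HasLaw (X p) (uniformOn (Set.Iio (S.height p.1.1))) μ)
    {x y w : List A} {n K i d : ℕ} (hd : d ≠ 0) (hw : w.length = S.height n)
    (hx : S.height n ≤ (occurrences x w).card * d)
    (hy : S.height n ≤ (occurrences y w).card * d) :
    ((d : ENNReal)⁻¹) ^ (2 * K) ≤ μ {ω | S.GroupJoins x y w n K i fun p => X p ω} := by
  have hd1 : (d : ENNReal)⁻¹ ≤ 1 := by
    rw [ENNReal.inv_le_one]
    exact_mod_cast Nat.one_le_iff_ne_zero.2 hd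
  refine (pow_le_pow_right_of_le_one' hd1 (S.card_blockGroup_le n (2 * K) i)).trans ?_
  refine pow_card_le_measure_forall_mem hind _
    (fun p => joiningRotations x y w (p.1.2 - (2 * K * i + 1))) fun p hp => ?_
  have hp1 := (S.mem_blockGroup.1 hp).1
  refine inv_le_measure_preimage_of_hasLaw (hunif p) ?_ hd
    (by have := S.lt_height p.1.1; omega) ?_
  · rw [hp1, ← hw]
    exact joiningRotations_subset _ _ _ _
  · rw [hp1]
    refine le_trans ?_ (Nat.mul_le_mul_right _ (min_card_le_card_joiningRotations x y w _))
    rw [← min_mul_mul_right]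
    exact le_min hx hy

/-- The success of a group depends on the random word `n`; fixing its value `w` makes the groups
independent of it and of each other. The finite alphabet leaves countably many values to sum over.
-/
theorem measure_forall_not_groupJoins_le [Finite A] (hX : ∀ p, Measurable (X p))
    (hind : iIndepFun X μ)
    (hunif : ∀ p, HasLaw (X p) (uniformOn (Set.Iio (S.height p.1.1))) μ)
    (x y : List A) (n K N : ℕ) {d : ℕ} (hd : d ≠ 0) :
    μ {ω | (S.height n ≤ (occurrences x (S.word (S.extend fun p => X p ω) n)).card * d ∧
        S.height n ≤ (occurrences y (S.word (S.extend fun p => X p ω) n)).card * d) ∧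
        ∀ i < N, ¬ S.GroupJoins x y (S.word (S.extend fun p => X p ω) n) n K i fun p => X p ω} ≤
      (1 - ((d : ENNReal)⁻¹) ^ (2 * K)) ^ N := by
  have := hind.isProbabilityMeasure
  have : Countable A := Finite.to_countable
  set F : Set Ω := _
  change μ F ≤ _
  set ε := (1 - ((d : ENNReal)⁻¹) ^ (2 * K)) ^ N
  let W : Ω → List A := fun ω => S.word (S.extend fun p => X p ω) n
  have hW : ∀ w, MeasurableSet (W ⁻¹' {w}) := fun w =>
    measurableSet_setOf_of_dependsOn hX (S.dependsOn_word n (· = w))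
  have hF : ∀ w, μ (F ∩ W ⁻¹' {w}) ≤ μ (W ⁻¹' {w}) * ε := by
    intro w
    -- For the other values `w` the intersection is empty.
    by_cases hg : (S.height n ≤ (occurrences x w).card * d ∧
        S.height n ≤ (occurrences y w).card * d) ∧ w.length = S.height n
    · refine le_trans (measure_mono ?_) (measure_and_forall_not_le hX hind
        (S.dependsOn_word n (· = w)) (S.dependsOn_groupJoins x y w n K)
        (S.disjoint_indicesBelow_blockGroup n (2 * K)) (S.pairwise_disjoint_blockGroup n (2 * K))
        fun i _ => le_measure_groupJoins hind hunif hd hg.2 hg.1.1 hg.1.2)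
      rintro ω ⟨⟨-, h⟩, rfl⟩
      exact ⟨rfl, h⟩
    · have : F ∩ W ⁻¹' {w} = ∅ := by
        rw [Set.eq_empty_iff_forall_notMem]
        rintro ω ⟨⟨h, -⟩, rfl⟩
        exact hg ⟨h, S.length_word _ _⟩
      simp [this]
  calc μ F ≤ μ (⋃ w, F ∩ W ⁻¹' {w}) := measure_mono fun ω hω => Set.mem_iUnion.2 ⟨W ω, hω, rfl⟩
    _ ≤ ∑' w, μ (F ∩ W ⁻¹' {w}) := measure_iUnion_le _
    _ ≤ ∑' w, μ (W ⁻¹' {w}) * ε := ENNReal.tsum_le_tsum hF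
    _ = (∑' w, μ (W ⁻¹' {w})) * ε := ENNReal.tsum_mul_right
    _ ≤ 1 * ε := by
      gcongr
      rw [← measure_univ (μ := μ)]
      exact tsum_measure_le_measure_univ (fun w => (hW w).nullMeasurableSet)
        fun w w' h => (Disjoint.preimage W (by simpa using h)).aedisjoint
    _ = ε := one_mul _

theorem ae_exists_abundant_append [Finite A] (hX : ∀ p, Measurable (X p))
    (hind : iIndepFun X μ)
    (hunif : ∀ p, HasLaw (X p) (uniformOn (Set.Iio (S.height p.1.1))) μ)
    (hq : Tendsto S.q atTop atTop) {x : List A} (hx : x ≠ []) (y : List A) :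
    ∀ᵐ ω ∂μ, ∀ m m', S.Abundant (S.extend fun p => X p ω) x m →
      S.Abundant (S.extend fun p => X p ω) y m' →
      ∃ n, S.Abundant (S.extend fun p => X p ω) (x ++ y) n := by
  rw [ae_all_iff]
  intro m
  rw [ae_all_iff]
  intro m'
  rw [ae_iff]
  -- The least number of occurrences that makes `x ++ y` abundant.
  set K := 2 * ((x ++ y).length - 1) + 1 with hK
  have hm := S.lt_height m
  have hm' := S.lt_height m'
  -- `Abundant.height_le` bounds the frequencies below by `1 / S.height m` and `1 / S.height m'`;
  -- the product serves both and does not depend on `n`.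
  set d := S.height m * S.height m' with hd_def
  have hd : d ≠ 0 := Nat.mul_ne_zero (by omega) (by omega)
  set δ : ENNReal := ((d : ENNReal)⁻¹) ^ (2 * K)
  have hδ : δ ≠ 0 := pow_ne_zero _ (ENNReal.inv_ne_zero.2 (ENNReal.natCast_ne_top d))
  have hN : Tendsto (fun n => (S.q n - 1) / (2 * K)) atTop atTop :=
    (Nat.tendsto_div_const_atTop (by omega)).comp
      ((tendsto_sub_atTop_nat 1).comp hq)
  have hlim := (ENNReal.tendsto_pow_atTop_nhds_zero_of_lt_one
    (ENNReal.sub_lt_self ENNReal.one_ne_top one_ne_zero hδ)).comp hN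
  -- The bad event lies in the failure event of every level `n ≥ max m m'`, whose measures tend to
  -- `0`.
  refine le_antisymm (ge_of_tendsto hlim ?_) zero_le
  filter_upwards [eventually_ge_atTop (max m m')] with n hn
  refine le_trans (measure_mono ?_)
    (measure_forall_not_groupJoins_le hX hind hunif x y n K ((S.q n - 1) / (2 * K)) hd)
  intro ω hω
  simp only [Set.mem_ofPred_eq, not_forall, not_exists] at hω
  obtain ⟨h1, h2, h3⟩ := hω
  refine ⟨⟨?_, ?_⟩, fun i hi hG => h3 (n + 1) ?_⟩
  · refine (h1.height_le (le_of_max_le_left hn)).trans (Nat.mul_le_mul_left _ ?_)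
    exact Nat.le_mul_of_pos_right _ (by omega)
  · refine (h2.height_le (le_of_max_le_right hn)).trans (Nat.mul_le_mul_left _ ?_)
    exact Nat.le_mul_of_pos_left _ (by omega)
  · have h4 : 2 * K * (i + 1) ≤ 2 * K * ((S.q n - 1) / (2 * K)) := Nat.mul_le_mul_left _ hi
    have h5 := Nat.mul_div_le (S.q n - 1) (2 * K)
    have h6 := S.two_le_q n
    have := hG.le_card_occurrences hx (by omega)
    unfold Abundant
    omega

theorem ae_forall_mem_wordLanguage [Finite A] (hX : ∀ p, Measurable (X p))
    (hind : iIndepFun X μ)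
    (hunif : ∀ p, HasLaw (X p) (uniformOn (Set.Iio (S.height p.1.1))) μ)
    (hq : Tendsto S.q atTop atTop) :
    ∀ᵐ ω ∂μ, ∀ u : List A, u ≠ [] → (∀ a ∈ u, a ∈ S.base) →
      u ∈ wordLanguage (S.limitWord (S.extend fun p => X p ω)) := by
  have : Countable A := Finite.to_countable
  have h : ∀ᵐ ω ∂μ, ∀ (a : A) (y : List A) (m m' : ℕ),
      S.Abundant (S.extend fun p => X p ω) [a] m → S.Abundant (S.extend fun p => X p ω) y m' →
      ∃ n, S.Abundant (S.extend fun p => X p ω) ([a] ++ y) n := by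
    simp_rw [ae_all_iff (ι := A), ae_all_iff (ι := List A)]
    exact fun a y => ae_exists_abundant_append hX hind hunif hq (by simp) y
  filter_upwards [h] with ω hω u hu hub
  suffices ∃ n, S.Abundant (S.extend fun p => X p ω) u n from this.elim fun n hn =>
    hn.mem_wordLanguage
  induction u with
  | nil => exact absurd rfl hu
  | cons a u ih =>
    have ha := abundant_singleton (S.extend fun p => X p ω) (hub a (by simp))
    by_cases hu' : u = []
    · subst hu'
      exact ⟨0, ha⟩
    · obtain ⟨n, hn⟩ := ih hu' fun b hb => hub b (by simp [hb])
      exact hω a u 0 n ha hn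

end Probability

end IcebergScheme

/-! ### From the full language on two letters to the complexity bound -/

theorem two_pow_le_wordComplexity {A : Type*} [Finite A] {z : ℕ → A} {a b : A} (hab : a ≠ b)
    {l : ℕ} (h : ∀ u : List A, u.length = l → (∀ c ∈ u, c = a ∨ c = b) → u ∈ wordLanguage z) :
    2 ^ l ≤ wordComplexity z l := by
  let f : (Fin l → Bool) → List A := fun g => List.ofFn fun i => cond (g i) a b
  have hf : Function.Injective f := by
    intro g g' hg
    have := List.ofFn_injective hg
    funext i
    have hi := congrFun this i
    cases h1 : g i <;> cases h2 : g' i <;> simp only [h1, h2, cond_true, cond_false] at hi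
    exacts [rfl, absurd hi.symm hab, absurd hi hab, rfl]
  have hcard : (Set.range f).ncard = 2 ^ l := by
    rw [← Set.image_univ, Set.ncard_image_of_injective _ hf, Set.ncard_univ]
    simp
  rw [← hcard]
  refine Set.ncard_le_ncard ?_ ((List.finite_length_eq A l).subset fun u hu => hu.2)
  rintro _ ⟨g, rfl⟩
  have hlen : (f g).length = l := List.length_ofFn
  refine ⟨h _ hlen fun c hc => ?_, hlen⟩
  obtain ⟨i, rfl⟩ := (List.mem_ofFn' _ _).1 hc
  change cond (g i) a b = a ∨ cond (g i) a b = b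
  cases g i <;> simp

theorem cube_le_two_pow {l : ℕ} (hl : 10 ≤ l) : l ^ 3 ≤ 2 ^ l := by
  induction l, hl using Nat.le_induction with
  | base => norm_num
  | succ l hl ih =>
    have : (l + 1) ^ 3 ≤ 2 * l ^ 3 := by nlinarith [Nat.mul_le_mul hl hl, Nat.zero_le (l * l * l)]
    calc (l + 1) ^ 3 ≤ 2 * l ^ 3 := this
      _ ≤ 2 * 2 ^ l := by gcongr
      _ = 2 ^ (l + 1) := by ring

theorem IcebergScheme.tendsto_q_atTop {A : Type*} (S : IcebergScheme A) {γ : ℝ} (hγ : 1 ≤ γ)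
    (hq : (fun n => (S.q n : ℝ)) ~[atTop] (fun n => (S.height n : ℝ) ^ γ)) :
    Tendsto S.q atTop atTop := by
  have hh : Tendsto S.height atTop atTop :=
    tendsto_atTop_mono (fun n => (S.lt_height n).le) tendsto_id
  have hh' : Tendsto (fun n => (S.height n : ℝ) ^ γ) atTop atTop :=
    (tendsto_rpow_atTop (by linarith)).comp (tendsto_natCast_atTop_atTop.comp hh)
  exact tendsto_natCast_atTop_iff.1 (hq.symm.tendsto_atTop hh')

theorem theorem5 {A : Type*} [Finite A] (S : IcebergScheme A)
    (γ : ℝ) (hγ : 1 ≤ γ)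
    (hq : (fun n => (S.q n : ℝ)) ~[atTop] (fun n => (S.height n : ℝ) ^ γ))
    {Ω : Type*} [MeasurableSpace Ω] (μ : Measure Ω) [IsProbabilityMeasure μ]
    (α : ℕ → ℕ → Ω → ℕ)
    (hunif : ∀ n j, 1 ≤ j → j < S.q n →
      HasLaw (α n j) (uniformOn (Set.Iio (S.height n))) μ)
    (hindep : iIndepFun
      (fun p : {p : ℕ × ℕ // 1 ≤ p.2 ∧ p.2 < S.q p.1} => α p.1.1 p.1.2) μ) :
    ∀ᵐ ω ∂μ, ∀ ε : ℝ, 0 < ε → ∃ l₀ : ℕ, ∀ l : ℕ, l₀ ≤ l →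
      (l : ℝ) ^ (3 - ε) ≤ (wordComplexity (S.limitWord fun n j => α n j ω) l : ℝ) := by
  have hae : ∀ p : S.RotationIndex, AEMeasurable (α p.1.1 p.1.2) μ := fun p =>
    (hunif _ _ p.2.1 p.2.2).aemeasurable
  -- The laws only give a.e. measurability, so measurable versions are used; they agree with `α` off
  -- a null set, the index set being countable.
  let X : S.RotationIndex → Ω → ℕ := fun p => (hae p).mk _
  have hXα : ∀ p : S.RotationIndex, α p.1.1 p.1.2 =ᵐ[μ] X p := fun p => (hae p).ae_eq_mk
  have hX : ∀ p, Measurable (X p) := fun p => (hae p).measurable_mk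
  have hlaw : ∀ p, HasLaw (X p) (uniformOn (Set.Iio (S.height p.1.1))) μ := fun p =>
    ⟨(hX p).aemeasurable, by rw [← Measure.map_congr (hXα p), (hunif _ _ p.2.1 p.2.2).map_eq]⟩
  obtain ⟨a, ha, b, hb, hab⟩ := S.base_nontrivial
  filter_upwards [IcebergScheme.ae_forall_mem_wordLanguage hX (hindep.congr hXα) hlaw
    (S.tendsto_q_atTop hγ hq), ae_all_iff.2 hXα] with ω hω hXω ε hε
  -- The threshold is that of `l ^ 3 ≤ 2 ^ l`, uniform in `ε` and `ω`.
  refine ⟨10, fun l hl => ?_⟩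
  have hword : S.limitWord (fun n j => α n j ω) = S.limitWord (S.extend fun p => X p ω) :=
    IcebergScheme.limitWord_congr fun m j h1 h2 => by
      rw [S.extend_of_lt _ h1 h2, ← hXω ⟨(m, j), h1, h2⟩]
  rw [hword]
  have h2 : 2 ^ l ≤ wordComplexity (S.limitWord (S.extend fun p => X p ω)) l := by
    refine two_pow_le_wordComplexity hab fun u hu hu' => hω u ?_ fun c hc => ?_
    · rintro rfl
      simp at hu
      omega
    · rcases hu' c hc with rfl | rfl
      exacts [ha, hb]
  have hl1 : (1 : ℝ) ≤ l := by exact_mod_cast (by omega : 1 ≤ l)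
  calc (l : ℝ) ^ (3 - ε) ≤ (l : ℝ) ^ (3 : ℝ) := Real.rpow_le_rpow_of_exponent_le hl1 (by linarith)
    _ = ((l ^ 3 : ℕ) : ℝ) := by
      rw [Nat.cast_pow, ← Real.rpow_natCast]
      norm_num
    _ ≤ _ := by exact_mod_cast (cube_le_two_pow hl).trans h2
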